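/- Let $\phi:\mathbb{R}\to\mathbb{R}$ be $1$-Lipschitz, let $n_{in}\ge1$ be an integer, let $\sigma_u,\sigma_w>0$, and assume $\gamma:=2\sqrt{2}\,\sigma_w<1$. On one probability space let there be given, for every width $n\ge 1$, random matrices $U_n\in\mathbb{R}^{n_{in}\times n}$ and $W_n\in\mathbb{R}^{n\times n}$ whose entries are all independent, those of $U_n$ with law $\mathcal{N}(0,\sigma_u^2/n_{in})$ and those of $W_n$ with law $\mathcal{N}(0,\sigma_w^2/n)$; the joint law for different $n$ is arbitrary. For $x\in\mathbb{R}^{n_{in}}$ put $h_n^0(x)=0$ and $h_n^{\ell}(x)=\phi\bigl(W_n^{T}h_n^{\ell-1}(x)+U_n^{T}x\bigr)\in\mathbb{R}^n$ for $\ell\ge1$, with $\phi$ applied entrywise, and let $\|\cdot\|$ be the Euclidean norm. Then almost surely there is a (random) $N$ such that for all $n\ge N$ and every $x$ with $\|x\|=1$ the following hold. 1. For all $k\ge\ell\ge0$, $$\|h_n^{\ell}(x)-h_n^{k}(x)\|\le\frac{\gamma^{\ell}\,(1-\gamma^{k-\ell})}{1-\gamma}\,\|h_n^1(x)\|.$$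 2. The limit $h_n^*(x)=\lim_{\ell\to\infty}h_n^{\ell}(x)$ exists, and it is the unique solution $h\in\mathbb{R}^n$ of $h=\phi(W_n^{T}h+U_n^{T}x)$. 3. For all $\ell\ge0$, $$\|h_n^{\ell}(x)\|\le\frac{1-\gamma^{\ell}}{1-\gamma}\,\|h_n^1(x)\|.$$ -/

import Mathlib

open MeasureTheory ProbabilityTheory Filter Topology
open scoped Matrix

/-- The transition map `h ↦ φ(Wᵀ h + Uᵀ x)` of a deep equilibrium model, with `φ` applied
entrywise. Feature vectors live in Euclidean space, so `‖·‖` is the Euclidean norm. -/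
def deqTransition {d n : ℕ} (φ : ℝ → ℝ) (U : Matrix (Fin d) (Fin n) ℝ)
    (W : Matrix (Fin n) (Fin n) ℝ) (x : EuclideanSpace ℝ (Fin d))
    (h : EuclideanSpace ℝ (Fin n)) : EuclideanSpace ℝ (Fin n) :=
  WithLp.toLp 2 fun i => φ ((Wᵀ *ᵥ h.ofLp + Uᵀ *ᵥ x.ofLp) i)

/-- The layers `h⁰(x) = 0` and `hˡ⁺¹(x) = φ(Wᵀ hˡ(x) + Uᵀ x)`. -/
def deqLayer {d n : ℕ} (φ : ℝ → ℝ) (U : Matrix (Fin d) (Fin n) ℝ)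
    (W : Matrix (Fin n) (Fin n) ℝ) (x : EuclideanSpace ℝ (Fin d)) :
    ℕ → EuclideanSpace ℝ (Fin n)
  | 0 => 0
  | l + 1 => deqTransition φ U W x (deqLayer φ U W x l)

/-- Random initialization at width `n`: the entries of `U` are `N(0, σᵤ² / d)`, the entries of
`W` are `N(0, σ_w² / n)`, and all these entries together are independent. -/
structure IsDEQInit {Ω : Type*} [MeasurableSpace Ω] (P : Measure Ω) {d n : ℕ} (σu σw : ℝ)
    (U : Ω → Matrix (Fin d) (Fin n) ℝ) (W : Ω → Matrix (Fin n) (Fin n) ℝ) : Prop where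
  hasLaw_U : ∀ i j, HasLaw (fun ω => U ω i j) (gaussianReal 0 (σu ^ 2 / d).toNNReal) P
  hasLaw_W : ∀ i j, HasLaw (fun ω => W ω i j) (gaussianReal 0 (σw ^ 2 / n).toNNReal) P
  indep : iIndepFun
    (Sum.elim (fun (p : Fin d × Fin n) ω => U ω p.1 p.2)
      (fun (p : Fin n × Fin n) ω => W ω p.1 p.2)) P

/-! Once `W` satisfies `‖Wᵀu‖ ≤ γ‖u‖` for all `u`, the layer map is a `γ`-contraction for every `x`
at once, and everything follows from Banach's fixed point argument. The probabilistic content is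
that this holds almost surely for all large `n`. No net over the sphere is needed. For a standard
Gaussian matrix `G`, put `F(G) = E‖Gy‖^(2n)` with `y` an independent standard Gaussian vector.
Cauchy–Schwarz gives `(2n-1)‼ ‖Gᵀu‖^(2n) ≤ ‖u‖^(2n) F(G)` simultaneously in `u`, while swapping the
integrals gives `E F(G) = (E‖y‖^(2n))²`. Markov's inequality then yields a tail bound summable in
`n` (`measure_exists_vecMul_gt_le`), and Borel–Cantelli concludes; it needs no independence across
widths. -/

/-! ### Moments of Gaussian vectors -/

theorem lintegral_exp_sq_div_three_gaussianReal :
    ∫⁻ z, ENNReal.ofReal (Real.exp (z ^ 2 / 3)) ∂gaussianReal 0 1 = ENNReal.ofReal (√3) := by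
  have hdens : ∀ z : ℝ, gaussianPDF 0 1 z * ENNReal.ofReal (Real.exp (z ^ 2 / 3)) =
      ENNReal.ofReal ((√(2 * Real.pi))⁻¹ * Real.exp (-(1 / 6) * z ^ 2)) := by
    intro z
    rw [gaussianPDF, ← ENNReal.ofReal_mul (gaussianPDFReal_nonneg _ _ _), gaussianPDFReal,
      mul_assoc, ← Real.exp_add]
    simp only [NNReal.coe_one, mul_one, sub_zero]
    congr 3
    ring
  rw [gaussianReal_of_var_ne_zero _ one_ne_zero,
    lintegral_withDensity_eq_lintegral_mul _ (measurable_gaussianPDF 0 1) (by fun_prop)]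
  simp only [Pi.mul_apply, hdens]
  rw [← ofReal_integral_eq_lintegral_ofReal
    ((integrable_exp_neg_mul_sq (by norm_num)).const_mul _)
    (Eventually.of_forall fun z => by positivity), integral_const_mul, integral_gaussian]
  congr 1
  rw [← Real.sqrt_inv, ← Real.sqrt_mul (by positivity)]
  congr 1
  field_simp
  norm_num

open scoped Nat in
theorem integral_pow_two_mul_gaussianReal (n : ℕ) :
    ∫ z, z ^ (2 * n) ∂gaussianReal 0 1 = (2 * n - 1 : ℕ)‼ := by
  rw [integral_gaussianReal_eq_integral_smul one_ne_zero]
  have hcongr : ∀ z : ℝ, gaussianPDFReal 0 1 z • z ^ (2 * n) =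
      (fun r : ℝ => (√(2 * Real.pi))⁻¹ * (r ^ (2 * n) * Real.exp (-(1 / 2) * r ^ 2))) |z| := by
    intro z
    simp only [gaussianPDFReal, NNReal.coe_one, mul_one, sub_zero, smul_eq_mul, sq_abs, pow_mul]
    rw [show -z ^ 2 / 2 = -(1 / 2) * z ^ 2 by ring]
    ring
  simp only [hcongr]
  rw [integral_comp_abs (f := fun r : ℝ =>
    (√(2 * Real.pi))⁻¹ * (r ^ (2 * n) * Real.exp (-(1 / 2) * r ^ 2))), integral_const_mul]
  have h := integral_rpow_mul_exp_neg_mul_rpow (p := 2) (q := (2 * n : ℕ)) (b := 1 / 2)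
    (by norm_num) (lt_of_lt_of_le (by norm_num) (Nat.cast_nonneg _)) (by norm_num)
  simp only [Real.rpow_natCast, Real.rpow_ofNat] at h
  rw [h, show (((2 * n : ℕ) : ℝ) + 1) / 2 = n + 1 / 2 by push_cast; ring,
    Real.Gamma_nat_add_half, show -(((2 * n : ℕ) : ℝ) + 1) / 2 = -(n + 1 / 2) by push_cast; ring,
    one_div, Real.inv_rpow (by norm_num), Real.rpow_neg (by norm_num), inv_inv,
    Real.rpow_add (by norm_num), Real.rpow_natCast, show (2 : ℝ) ^ (2 : ℝ)⁻¹ = √2 by rw [Real.sqrt_eq_rpow, one_div],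
    Real.sqrt_mul (by norm_num)]
  have h2 : √(2 : ℝ) ≠ 0 := by positivity
  have hpi : √Real.pi ≠ 0 := by positivity
  field_simp

open scoped Nat in
theorem lintegral_pow_two_mul_gaussianReal (n : ℕ) :
    ∫⁻ z, ENNReal.ofReal (z ^ (2 * n)) ∂gaussianReal 0 1 =
      ENNReal.ofReal ((2 * n - 1 : ℕ)‼ : ℝ) := by
  have hint : Integrable (fun z : ℝ => z ^ (2 * n)) (gaussianReal 0 1) := by
    have h := (memLp_id_gaussianReal (μ := 0) (v := 1) (2 * n : ℕ)).integrable_norm_pow'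
    simpa [pow_mul] using h
  rw [← integral_pow_two_mul_gaussianReal, ofReal_integral_eq_lintegral_ofReal hint
    (Eventually.of_forall fun z => (even_two_mul n).pow_nonneg z)]

theorem pow_le_mul_exp_div_three (n : ℕ) {r : ℝ} (hr : 0 ≤ r) :
    r ^ n ≤ (3 * n / Real.exp 1) ^ n * Real.exp (r / 3) := by
  rcases Nat.eq_zero_or_pos n with rfl | hn
  · simpa using Real.one_le_exp (by positivity : 0 ≤ r / 3)
  have hn' : (0 : ℝ) < n := by exact_mod_cast hn
  have h1 : r ≤ 3 * n / Real.exp 1 * Real.exp (r / (3 * n)) := by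
    -- The tangent bound `1 + s ≤ exp s`, tight at `r = 3n`.
    have := Real.add_one_le_exp (r / (3 * n) - 1)
    rw [Real.exp_sub, sub_add_cancel, div_le_iff₀ (by positivity)] at this
    calc r ≤ _ := this
      _ = _ := by ring
  calc r ^ n ≤ (3 * n / Real.exp 1 * Real.exp (r / (3 * n))) ^ n := by gcongr
    _ = _ := by
      rw [mul_pow, ← Real.exp_nat_mul]
      congr 2
      field_simp

/-- The power is dominated by an exponential, whose mean factors over coordinates. The rate `1/3`
minimizes the resulting bound `(n/(es))^n (1-2s)^(-n/2)` over `s`. -/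
theorem lintegral_sum_sq_pow_pi_gaussianReal_le (n : ℕ) :
    ∫⁻ z : Fin n → ℝ, ENNReal.ofReal ((∑ i, z i ^ 2) ^ n) ∂Measure.pi (fun _ => gaussianReal 0 1) ≤
      ENNReal.ofReal ((3 * √3 * n / Real.exp 1) ^ n) := by
  have hind := iIndepFun_pi (μ := fun _ : Fin n => gaussianReal 0 1)
    (X := fun _ z => ENNReal.ofReal (Real.exp (z ^ 2 / 3))) (fun _ => by fun_prop)
  have hprod : ∫⁻ z : Fin n → ℝ, ∏ i, ENNReal.ofReal (Real.exp (z i ^ 2 / 3))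
      ∂Measure.pi (fun _ => gaussianReal 0 1) = ENNReal.ofReal (√3) ^ n := by
    rw [lintegral_prod_eq_prod_lintegral_of_indepFun Finset.univ _ hind (fun i => by fun_prop)]
    have h : ∀ i : Fin n, ∫⁻ z : Fin n → ℝ, ENNReal.ofReal (Real.exp (z i ^ 2 / 3))
        ∂Measure.pi (fun _ => gaussianReal 0 1) = ENNReal.ofReal (√3) := by
      intro i
      rw [← lintegral_exp_sq_div_three_gaussianReal,
        ← (measurePreserving_eval (fun _ : Fin n => gaussianReal 0 1) i).lintegral_comp
          (f := fun z => ENNReal.ofReal (Real.exp (z ^ 2 / 3))) (by fun_prop)]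
    simp [h]
  calc _ ≤ ∫⁻ z : Fin n → ℝ, ENNReal.ofReal ((3 * n / Real.exp 1) ^ n) *
        ∏ i, ENNReal.ofReal (Real.exp (z i ^ 2 / 3)) ∂Measure.pi (fun _ => gaussianReal 0 1) := by
        refine lintegral_mono fun z => ?_
        rw [← ENNReal.ofReal_prod_of_nonneg (fun i _ => (Real.exp_pos _).le), ← Real.exp_sum,
          ← ENNReal.ofReal_mul (by positivity), ← Finset.sum_div]
        exact ENNReal.ofReal_le_ofReal
          (pow_le_mul_exp_div_three n (Finset.sum_nonneg fun i _ => sq_nonneg _))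
    _ = _ := by
        rw [lintegral_const_mul _ (by fun_prop), hprod, ← ENNReal.ofReal_pow (by positivity),
          ← ENNReal.ofReal_mul (by positivity), ← mul_pow]
        ring_nf

theorem map_sum_mul_pi_gaussianReal {n : ℕ} (a : Fin n → ℝ) :
    (Measure.pi fun _ : Fin n => gaussianReal 0 1).map (fun z => ∑ j, a j * z j) =
      (gaussianReal 0 1).map (fun t => √(∑ j, a j ^ 2) * t) := by
  have h := IsGaussian.map_eq_gaussianReal (μ := stdGaussian (EuclideanSpace ℝ (Fin n)))
    (innerSL ℝ (WithLp.toLp 2 a))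
  rw [integral_strongDual_stdGaussian, variance_dual_stdGaussian, innerSL_apply_norm,
    ← map_pi_eq_stdGaussian, Measure.map_map (by fun_prop) (by fun_prop),
    EuclideanSpace.real_norm_sq_eq] at h
  rw [gaussianReal_map_const_mul]
  convert h using 2
  · ext z
    simp [PiLp.inner_apply, mul_comm]
  · simp
  · ext
    rw [Real.coe_toNNReal _ (Finset.sum_nonneg fun i _ => sq_nonneg _)]
    simp [Real.sq_sqrt (Finset.sum_nonneg fun i _ => sq_nonneg (a i))]

/-! ### Tail of the operator norm of a Gaussian matrix -/

/-- For fixed `y`, the entries of `Ay` are i.i.d. `N(0, ‖y‖²)`. -/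
theorem lintegral_mulVec_sum_sq_pow_le {n : ℕ} (y : Fin n → ℝ) :
    ∫⁻ A : Fin n → Fin n → ℝ, ENNReal.ofReal ((∑ i, (∑ j, y j * A i j) ^ 2) ^ n)
        ∂Measure.pi (fun _ => Measure.pi fun _ => gaussianReal 0 1) ≤
      ENNReal.ofReal ((3 * √3 * n / Real.exp 1) ^ n) * ENNReal.ofReal ((∑ j, y j ^ 2) ^ n) := by
  set c := √(∑ j, y j ^ 2) with hc
  have hc2 : c ^ 2 = ∑ j, y j ^ 2 := Real.sq_sqrt (Finset.sum_nonneg fun i _ => sq_nonneg _)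
  have hmap : (Measure.pi fun _ : Fin n => Measure.pi fun _ : Fin n => gaussianReal 0 1).map
      (fun A i => ∑ j, y j * A i j) =
      (Measure.pi fun _ : Fin n => gaussianReal 0 1).map (fun z i => c * z i) := by
    have : ∀ i : Fin n, IsProbabilityMeasure ((gaussianReal 0 1).map (fun t => c * t)) :=
      fun _ => Measure.isProbabilityMeasure_map (by fun_prop)
    have : ∀ i : Fin n, IsProbabilityMeasure
        ((Measure.pi fun _ : Fin n => gaussianReal 0 1).map (fun z => ∑ j, y j * z j)) :=
      fun _ => Measure.isProbabilityMeasure_map (Measurable.aemeasurable (by fun_prop))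
    rw [Measure.pi_map_pi (f := fun (_ : Fin n) (z : Fin n → ℝ) => ∑ j, y j * z j)
        (fun _ => Measurable.aemeasurable (by fun_prop)),
      Measure.pi_map_pi (f := fun _ t => c * t) (fun _ => by fun_prop)]
    simp only [map_sum_mul_pi_gaussianReal, hc]
  rw [← lintegral_map (f := fun z : Fin n → ℝ => ENNReal.ofReal ((∑ i, z i ^ 2) ^ n))
    (by fun_prop) (by fun_prop), hmap, lintegral_map (by fun_prop) (by fun_prop)]
  simp only [mul_pow, ← Finset.mul_sum, hc2]
  simp_rw [ENNReal.ofReal_mul (pow_nonneg (Finset.sum_nonneg fun i _ => sq_nonneg (y i)) n)]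
  rw [lintegral_const_mul _ (by fun_prop), mul_comm]
  gcongr
  exact lintegral_sum_sq_pow_pi_gaussianReal_le n

open scoped Nat in
theorem doubleFactorial_mul_vecMul_le_lintegral {n : ℕ} (A : Fin n → Fin n → ℝ) (u : Fin n → ℝ) :
    ENNReal.ofReal ((2 * n - 1 : ℕ)‼ : ℝ) *
        ENNReal.ofReal ((∑ j, (∑ i, u i * A i j) ^ 2) ^ n) ≤
      ENNReal.ofReal ((∑ i, u i ^ 2) ^ n) *
        ∫⁻ y : Fin n → ℝ, ENNReal.ofReal ((∑ i, (∑ j, y j * A i j) ^ 2) ^ n)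
          ∂Measure.pi (fun _ => gaussianReal 0 1) := by
  set a : Fin n → ℝ := fun j => ∑ i, u i * A i j with ha
  have hleft : ∫⁻ y : Fin n → ℝ, ENNReal.ofReal ((∑ j, a j * y j) ^ (2 * n))
      ∂Measure.pi (fun _ => gaussianReal 0 1) =
      ENNReal.ofReal ((2 * n - 1 : ℕ)‼ : ℝ) * ENNReal.ofReal ((∑ j, a j ^ 2) ^ n) := by
    rw [← lintegral_map (f := fun t : ℝ => ENNReal.ofReal (t ^ (2 * n))) (by fun_prop)
      (by fun_prop), map_sum_mul_pi_gaussianReal, lintegral_map (by fun_prop) (by fun_prop)]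
    simp_rw [mul_pow _ _ (2 * n), ENNReal.ofReal_mul ((even_two_mul n).pow_nonneg _)]
    rw [lintegral_const_mul _ (by fun_prop), lintegral_pow_two_mul_gaussianReal, mul_comm, pow_mul,
      Real.sq_sqrt (Finset.sum_nonneg fun i _ => sq_nonneg _)]
  rw [← hleft, ← lintegral_const_mul _ (by fun_prop)]
  refine lintegral_mono fun y => ?_
  rw [← ENNReal.ofReal_mul (pow_nonneg (Finset.sum_nonneg fun i _ => sq_nonneg (u i)) n),
    ← mul_pow, pow_mul]
  refine ENNReal.ofReal_le_ofReal (pow_le_pow_left₀ (sq_nonneg _) ?_ n)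
  -- Duality `⟨Aᵀu, y⟩ = ⟨u, Ay⟩`, ready for Cauchy–Schwarz.
  have hswap : ∑ j, a j * y j = ∑ i, u i * ∑ j, y j * A i j := by
    simp only [ha, Finset.sum_mul, Finset.mul_sum]
    rw [Finset.sum_comm]
    exact Finset.sum_congr rfl fun i _ => Finset.sum_congr rfl fun j _ => by ring
  rw [hswap]
  exact Finset.sum_mul_sq_le_sq_mul_sq _ _ _

open scoped Nat in
theorem measure_exists_vecMul_gt_le {Ω : Type*} [MeasurableSpace Ω] {P : Measure Ω} {n : ℕ}
    {G : Ω → Fin n → Fin n → ℝ}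
    (hG : HasLaw G (Measure.pi fun _ => Measure.pi fun _ => gaussianReal 0 1) P)
    {t : ℝ} (ht : 0 < t) :
    P {ω | ∃ u : Fin n → ℝ, t * ∑ i, u i ^ 2 < ∑ j, (∑ i, u i * G ω i j) ^ 2} ≤
      ENNReal.ofReal (((3 * √3 * n / Real.exp 1) ^ n) ^ 2 / ((2 * n - 1 : ℕ)‼ * t ^ n)) := by
  set F : (Fin n → Fin n → ℝ) → ENNReal := fun A =>
    ∫⁻ y : Fin n → ℝ, ENNReal.ofReal ((∑ i, (∑ j, y j * A i j) ^ 2) ^ n)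
      ∂Measure.pi (fun _ => gaussianReal 0 1) with hF
  have hmeas : Measurable (Function.uncurry fun (A : Fin n → Fin n → ℝ) (y : Fin n → ℝ) =>
      ENNReal.ofReal ((∑ i, (∑ j, y j * A i j) ^ 2) ^ n)) := by
    unfold Function.uncurry
    fun_prop
  have hFmeas : Measurable F := hmeas.lintegral_prod_right
  have hK : (0 : ℝ) < (2 * n - 1 : ℕ)‼ := by exact_mod_cast Nat.doubleFactorial_pos _
  have hC : 0 ≤ (3 * √3 * n / Real.exp 1) ^ n := by positivity
  have hFint : ∫⁻ ω, F (G ω) ∂P ≤ ENNReal.ofReal (((3 * √3 * n / Real.exp 1) ^ n) ^ 2) := by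
    rw [hG.lintegral_comp hFmeas.aemeasurable, hF, lintegral_lintegral_swap hmeas.aemeasurable]
    calc _ ≤ ∫⁻ y : Fin n → ℝ, ENNReal.ofReal ((3 * √3 * n / Real.exp 1) ^ n) *
          ENNReal.ofReal ((∑ j, y j ^ 2) ^ n) ∂Measure.pi (fun _ => gaussianReal 0 1) :=
          lintegral_mono fun y => lintegral_mulVec_sum_sq_pow_le y
      _ ≤ _ := by
          rw [lintegral_const_mul _ (by fun_prop), sq, ENNReal.ofReal_mul hC]
          gcongr
          exact lintegral_sum_sq_pow_pi_gaussianReal_le n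
  have hsub : {ω | ∃ u : Fin n → ℝ, t * ∑ i, u i ^ 2 < ∑ j, (∑ i, u i * G ω i j) ^ 2} ⊆
      {ω | ENNReal.ofReal ((2 * n - 1 : ℕ)‼ * t ^ n) ≤ F (G ω)} := by
    rintro ω ⟨u, hu⟩
    -- The strict inequality excludes `u = 0`, so `‖u‖^(2n)` can be cancelled.
    have hS : 0 < ∑ i, u i ^ 2 := by
      refine (Finset.sum_nonneg fun i _ => sq_nonneg _).lt_of_ne fun h0 => ?_
      have hz : ∀ i, u i = 0 := fun i => by
        have := (Finset.sum_eq_zero_iff_of_nonneg fun i _ => sq_nonneg (u i)).1 h0.symm i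
          (Finset.mem_univ i)
        simpa using this
      simp [hz] at hu
    have hSn : 0 < (∑ i, u i ^ 2) ^ n := pow_pos hS n
    have h1 : ENNReal.ofReal ((∑ i, u i ^ 2) ^ n) * ENNReal.ofReal ((2 * n - 1 : ℕ)‼ * t ^ n) ≤
        ENNReal.ofReal ((∑ i, u i ^ 2) ^ n) * F (G ω) := by
      refine le_trans ?_ (doubleFactorial_mul_vecMul_le_lintegral (G ω) u)
      rw [← ENNReal.ofReal_mul hSn.le, ← ENNReal.ofReal_mul hK.le]
      refine ENNReal.ofReal_le_ofReal ?_
      rw [mul_left_comm, ← mul_pow, mul_comm _ t]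
      gcongr
    exact (ENNReal.mul_le_mul_iff_right (by simpa using hSn) ENNReal.ofReal_ne_top).1 h1
  have hpos : 0 < ((2 * n - 1 : ℕ)‼ : ℝ) * t ^ n := by positivity
  calc _ ≤ P {ω | ENNReal.ofReal ((2 * n - 1 : ℕ)‼ * t ^ n) ≤ F (G ω)} := measure_mono hsub
    _ ≤ (∫⁻ ω, F (G ω) ∂P) / ENNReal.ofReal ((2 * n - 1 : ℕ)‼ * t ^ n) :=
        meas_ge_le_lintegral_div (hFmeas.comp_aemeasurable hG.aemeasurable)
          (ENNReal.ofReal_pos.2 hpos).ne' ENNReal.ofReal_ne_top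
    _ ≤ _ := by
        rw [ENNReal.ofReal_div_of_pos hpos]
        gcongr

open scoped Nat in
theorem two_pow_mul_factorial_le {n : ℕ} (hn : 1 ≤ n) :
    2 ^ n * n ! ≤ 2 * n * (2 * n - 1)‼ := by
  induction n, hn using Nat.le_induction with
  | base => simp
  | succ n hn ih =>
    have h : (2 * (n + 1) - 1)‼ = (2 * n + 1) * (2 * n - 1)‼ := by
      rw [show 2 * (n + 1) - 1 = (2 * n - 1) + 2 by omega, Nat.doubleFactorial_add_two]
      congr 1
      omega
    rw [h, Nat.factorial_succ, pow_succ]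
    nlinarith [Nat.zero_le ((n + 1) * (2 * n - 1)‼)]

-- Since `(2n-1)‼` is at least `(2n/e)^n / (2n)`, the ratio decays geometrically once `t/n` exceeds
-- `27/(2e) < 5`; the value `8` is what `γ² = 8σ_w²` provides.
open scoped Nat in
theorem gaussian_operator_tail_bound_le {n : ℕ} (hn : 1 ≤ n) :
    ((3 * √3 * n / Real.exp 1) ^ n) ^ 2 / ((2 * n - 1 : ℕ)‼ * (8 * n : ℝ) ^ n) ≤
      2 * (n * (27 / (16 * Real.exp 1)) ^ n) := by
  have hn0 : (0 : ℝ) < n := by exact_mod_cast hn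
  have hK : (0 : ℝ) < (2 * n - 1 : ℕ)‼ := by exact_mod_cast Nat.doubleFactorial_pos _
  have h1 : (2 : ℝ) ^ n * n ! ≤ 2 * n * (2 * n - 1 : ℕ)‼ := by
    exact_mod_cast two_pow_mul_factorial_le hn
  have h2 : (n : ℝ) ^ n ≤ Real.exp 1 ^ n * n ! := by
    have := Real.pow_div_factorial_le_exp (n : ℝ) hn0.le n
    rw [div_le_iff₀ (by positivity)] at this
    rwa [← Real.exp_nat_mul, mul_one]
  have h3 : (2 * n / Real.exp 1) ^ n ≤ 2 * n * ((2 * n - 1 : ℕ)‼ : ℝ) := by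
    refine le_trans ?_ h1
    rw [div_pow, mul_pow, div_le_iff₀ (by positivity), mul_assoc]
    gcongr
    rwa [mul_comm]
  rw [div_le_iff₀ (by positivity)]
  have hs : √(3 : ℝ) ^ 2 = 3 := Real.sq_sqrt (by norm_num)
  calc ((3 * √3 * n / Real.exp 1) ^ n) ^ 2
      = (27 / (16 * Real.exp 1)) ^ n * (8 * n : ℝ) ^ n * (2 * n / Real.exp 1) ^ n := by
        rw [pow_right_comm, ← mul_pow, ← mul_pow]
        congr 1
        rw [div_pow, mul_pow, mul_pow, hs]
        field_simp
        norm_num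
    _ ≤ (27 / (16 * Real.exp 1)) ^ n * (8 * n : ℝ) ^ n * (2 * n * ((2 * n - 1 : ℕ)‼ : ℝ)) := by
        gcongr
    _ = _ := by ring

theorem summable_gaussian_operator_tail_bound :
    Summable fun n : ℕ => 2 * (n * (27 / (16 * Real.exp 1)) ^ n) := by
  refine Summable.mul_left _ ?_
  have he : 27 / (16 * Real.exp 1) < 1 := by
    rw [div_lt_one (by positivity)]
    linarith [Real.exp_one_gt_d9]
  have h := summable_pow_mul_geometric_of_norm_lt_one (R := ℝ) 1
    (r := 27 / (16 * Real.exp 1)) (by rwa [Real.norm_of_nonneg (by positivity)])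
  simpa using h

/-! ### Deterministic contraction estimates -/

theorem dist_deqTransition_le {d n : ℕ} {φ : ℝ → ℝ} (hφ : LipschitzWith 1 φ)
    (U : Matrix (Fin d) (Fin n) ℝ) {W : Matrix (Fin n) (Fin n) ℝ} {γ : ℝ} (hγ : 0 ≤ γ)
    (hW : ∀ u : Fin n → ℝ, ∑ j, (∑ i, u i * W i j) ^ 2 ≤ γ ^ 2 * ∑ i, u i ^ 2)
    (x : EuclideanSpace ℝ (Fin d)) (h k : EuclideanSpace ℝ (Fin n)) :
    dist (deqTransition φ U W x h) (deqTransition φ U W x k) ≤ γ * dist h k := by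
  rw [dist_eq_norm, dist_eq_norm]
  refine le_of_sq_le_sq ?_ (by positivity)
  rw [mul_pow, EuclideanSpace.real_norm_sq_eq, EuclideanSpace.real_norm_sq_eq]
  refine le_trans (Finset.sum_le_sum fun j _ => ?_) (hW (h - k).ofLp)
  have hlip := hφ.dist_le_mul ((Wᵀ *ᵥ h.ofLp + Uᵀ *ᵥ x.ofLp) j) ((Wᵀ *ᵥ k.ofLp + Uᵀ *ᵥ x.ofLp) j)
  rw [NNReal.coe_one, one_mul, Real.dist_eq, Real.dist_eq] at hlip
  have hdiff : (Wᵀ *ᵥ h.ofLp + Uᵀ *ᵥ x.ofLp) j - (Wᵀ *ᵥ k.ofLp + Uᵀ *ᵥ x.ofLp) j =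
      ∑ i, (h - k).ofLp i * W i j := by
    simp [Matrix.mulVec, dotProduct, mul_comm, ← Finset.sum_sub_distrib, ← mul_sub]
  rw [hdiff] at hlip
  simpa [deqTransition] using sq_le_sq.2 hlip

theorem norm_deqLayer_sub_deqLayer_le {d n : ℕ} {φ : ℝ → ℝ} {U : Matrix (Fin d) (Fin n) ℝ}
    {W : Matrix (Fin n) (Fin n) ℝ} {x : EuclideanSpace ℝ (Fin d)} {γ : ℝ} (hγ : 0 ≤ γ)
    (hγ1 : γ < 1)
    (hT : ∀ h k, dist (deqTransition φ U W x h) (deqTransition φ U W x k) ≤ γ * dist h k)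
    {l k : ℕ} (hlk : l ≤ k) :
    ‖deqLayer φ U W x l - deqLayer φ U W x k‖ ≤
      γ ^ l * (1 - γ ^ (k - l)) / (1 - γ) * ‖deqLayer φ U W x 1‖ := by
  have hsub : (0 : ℝ) < 1 - γ := sub_pos.2 hγ1
  have hstep : ∀ m, ‖deqLayer φ U W x m - deqLayer φ U W x (m + 1)‖ ≤
      γ ^ m * ‖deqLayer φ U W x 1‖ := by
    intro m
    induction m with
    | zero => simp [deqLayer]
    | succ m ih =>
      have h := hT (deqLayer φ U W x m) (deqLayer φ U W x (m + 1))
      rw [dist_eq_norm, dist_eq_norm] at h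
      refine h.trans ?_
      rw [pow_succ', mul_assoc]
      gcongr
  obtain ⟨m, rfl⟩ := Nat.exists_eq_add_of_le hlk
  rw [Nat.add_sub_cancel_left]
  clear hlk
  induction m with
  | zero => simp
  | succ m ih =>
    calc _ ≤ ‖deqLayer φ U W x l - deqLayer φ U W x (l + m)‖ +
          ‖deqLayer φ U W x (l + m) - deqLayer φ U W x (l + m + 1)‖ :=
            norm_sub_le_norm_sub_add_norm_sub _ _ _
      _ ≤ γ ^ l * (1 - γ ^ m) / (1 - γ) * ‖deqLayer φ U W x 1‖ +
          γ ^ (l + m) * ‖deqLayer φ U W x 1‖ := add_le_add ih (hstep _)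
      _ = _ := by
          field_simp
          ring

theorem exists_tendsto_deqLayer {d n : ℕ} {φ : ℝ → ℝ} {U : Matrix (Fin d) (Fin n) ℝ}
    {W : Matrix (Fin n) (Fin n) ℝ} {x : EuclideanSpace ℝ (Fin d)} {γ : ℝ} (hγ : 0 ≤ γ)
    (hγ1 : γ < 1)
    (hT : ∀ h k, dist (deqTransition φ U W x h) (deqTransition φ U W x k) ≤ γ * dist h k) :
    ∃ hstar : EuclideanSpace ℝ (Fin n),
      Tendsto (deqLayer φ U W x) atTop (𝓝 hstar) ∧ deqTransition φ U W x hstar = hstar ∧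
      ∀ h, deqTransition φ U W x h = h → h = hstar := by
  have hc : ContractingWith ⟨γ, hγ⟩ (deqTransition φ U W x) :=
    ⟨by exact_mod_cast hγ1, LipschitzWith.of_dist_le_mul hT⟩
  have hiter : deqLayer φ U W x = fun l => (deqTransition φ U W x)^[l] 0 := by
    funext l
    induction l with
    | zero => rfl
    | succ l ih => rw [Function.iterate_succ_apply', ← ih]; rfl
  refine ⟨hc.fixedPoint, ?_, hc.fixedPoint_isFixedPt, fun h hh => hc.fixedPoint_unique hh⟩
  rw [hiter]
  exact hc.tendsto_iterate_fixedPoint 0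

/-! ### Rescaling the weights and Borel–Cantelli -/

theorem IsDEQInit.hasLaw_pi_pi_W_div {Ω : Type*} [MeasurableSpace Ω] {P : Measure Ω}
    [IsProbabilityMeasure P] {d n : ℕ} {σu σw : ℝ} {U : Ω → Matrix (Fin d) (Fin n) ℝ}
    {W : Ω → Matrix (Fin n) (Fin n) ℝ} (hinit : IsDEQInit P σu σw U W) (hσw : 0 < σw)
    (hn : 1 ≤ n) :
    HasLaw (fun ω i j => W ω i j / (σw / √n))
      (Measure.pi fun _ : Fin n => Measure.pi fun _ : Fin n => gaussianReal 0 1) P := by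
  have hn0 : (0 : ℝ) < n := by exact_mod_cast hn
  have hind : iIndepFun (fun (p : Fin n × Fin n) ω => W ω p.1 p.2 / (σw / √n)) P :=
    (hinit.indep.precomp (Sum.inr_injective)).comp (fun _ t => t / (σw / √n))
      (fun _ => by fun_prop)
  have hlaw : ∀ p : Fin n × Fin n,
      HasLaw (fun ω => W ω p.1 p.2 / (σw / √n)) (gaussianReal 0 1) P := by
    intro p
    convert gaussianReal_div_const (hinit.hasLaw_W p.1 p.2) (σw / √n) using 2
    · simp
    · ext
      have hsq : (σw / √n) ^ 2 = σw ^ 2 / n := by rw [div_pow, Real.sq_sqrt hn0.le]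
      push_cast
      rw [Real.coe_toNNReal _ (by positivity), ← hsq]
      exact (div_self (by positivity)).symm
  have hcurry : MeasurePreserving (MeasurableEquiv.curry (Fin n) (Fin n) ℝ)
      (Measure.pi fun _ : Fin n × Fin n => gaussianReal 0 1)
      (Measure.pi fun _ : Fin n => Measure.pi fun _ : Fin n => gaussianReal 0 1) :=
    ⟨by fun_prop, by
      simpa only [Measure.infinitePi_eq_pi] using
        Measure.infinitePi_map_curry fun (_ _ : Fin n) => gaussianReal 0 1⟩
  exact hcurry.comp_hasLaw (hind.hasLaw_pi hlaw)

theorem IsDEQInit.measure_exists_vecMul_gt_le {Ω : Type*} [MeasurableSpace Ω] {P : Measure Ω}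
    [IsProbabilityMeasure P] {d n : ℕ} {σu σw : ℝ} {U : Ω → Matrix (Fin d) (Fin n) ℝ}
    {W : Ω → Matrix (Fin n) (Fin n) ℝ} (hinit : IsDEQInit P σu σw U W) (hσw : 0 < σw)
    (hn : 1 ≤ n) :
    P {ω | ∃ u : Fin n → ℝ, 8 * σw ^ 2 * ∑ i, u i ^ 2 < ∑ j, (∑ i, u i * W ω i j) ^ 2} ≤
      ENNReal.ofReal (2 * (n * (27 / (16 * Real.exp 1)) ^ n)) := by
  have hn0 : (0 : ℝ) < n := by exact_mod_cast hn
  refine le_trans (measure_mono ?_) ((_root_.measure_exists_vecMul_gt_le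
    (hinit.hasLaw_pi_pi_W_div hσw hn) (by positivity : (0 : ℝ) < 8 * n)).trans
    (ENNReal.ofReal_le_ofReal (gaussian_operator_tail_bound_le hn)))
  rintro ω ⟨u, hu⟩
  refine ⟨u, ?_⟩
  simp only [← mul_div_assoc, ← Finset.sum_div, div_pow]
  rw [Real.sq_sqrt hn0.le, lt_div_iff₀ (by positivity)]
  refine lt_of_eq_of_lt ?_ hu
  field_simp

theorem ae_eventually_sum_vecMul_sq_le {Ω : Type*} [MeasurableSpace Ω] (P : Measure Ω)
    [IsProbabilityMeasure P] {d : ℕ} {σu σw : ℝ} (hσw : 0 < σw)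
    {U : (n : ℕ) → Ω → Matrix (Fin d) (Fin n) ℝ} {W : (n : ℕ) → Ω → Matrix (Fin n) (Fin n) ℝ}
    (hinit : ∀ n : ℕ, 1 ≤ n → IsDEQInit P σu σw (U n) (W n)) :
    ∀ᵐ ω ∂P, ∀ᶠ n in atTop, ∀ u : Fin n → ℝ,
      ∑ j, (∑ i, u i * W n ω i j) ^ 2 ≤ 8 * σw ^ 2 * ∑ i, u i ^ 2 := by
  have hsum : ∑' n : ℕ, P {ω | ∃ u : Fin n → ℝ,
      8 * σw ^ 2 * ∑ i, u i ^ 2 < ∑ j, (∑ i, u i * W n ω i j) ^ 2} ≠ ⊤ := by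
    refine ne_top_of_le_ne_top summable_gaussian_operator_tail_bound.tsum_ofReal_ne_top
      (ENNReal.tsum_le_tsum fun n => ?_)
    rcases Nat.eq_zero_or_pos n with rfl | hn
    -- At `n = 0` both sums are empty, so the event is empty.
    · simp
    · exact (hinit n hn).measure_exists_vecMul_gt_le hσw hn
  filter_upwards [ae_eventually_notMem hsum] with ω hω
  filter_upwards [hω] with n hn u
  simp only [not_exists, not_lt] at hn
  exact hn u

theorem lemmaE1 {Ω : Type*} [MeasurableSpace Ω] (P : Measure Ω) [IsProbabilityMeasure P]
    (d : ℕ) (φ : ℝ → ℝ) (hφ : LipschitzWith 1 φ)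
    (σu σw γ : ℝ) (hσu : 0 < σu) (hσw : 0 < σw)
    (hγ : γ = 2 * Real.sqrt 2 * σw) (hγ1 : γ < 1)
    (U : (n : ℕ) → Ω → Matrix (Fin d) (Fin n) ℝ)
    (W : (n : ℕ) → Ω → Matrix (Fin n) (Fin n) ℝ)
    (hinit : ∀ n : ℕ, 1 ≤ n → IsDEQInit P σu σw (U n) (W n)) :
    ∀ᵐ ω ∂P, ∃ N : ℕ, ∀ n : ℕ, N ≤ n →
      ∀ x : EuclideanSpace ℝ (Fin d), ‖x‖ = 1 →
        (∀ l k : ℕ, l ≤ k →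
          ‖deqLayer φ (U n ω) (W n ω) x l - deqLayer φ (U n ω) (W n ω) x k‖ ≤
            γ ^ l * (1 - γ ^ (k - l)) / (1 - γ) * ‖deqLayer φ (U n ω) (W n ω) x 1‖) ∧
        (∃ hstar : EuclideanSpace ℝ (Fin n),
          Tendsto (deqLayer φ (U n ω) (W n ω) x) atTop (𝓝 hstar) ∧
          deqTransition φ (U n ω) (W n ω) x hstar = hstar ∧
          ∀ h : EuclideanSpace ℝ (Fin n),
            deqTransition φ (U n ω) (W n ω) x h = h → h = hstar) ∧
        (∀ l : ℕ,
          ‖deqLayer φ (U n ω) (W n ω) x l‖ ≤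
            (1 - γ ^ l) / (1 - γ) * ‖deqLayer φ (U n ω) (W n ω) x 1‖) := by
  have hγ0 : 0 ≤ γ := by rw [hγ]; positivity
  have hγ2 : γ ^ 2 = 8 * σw ^ 2 := by
    rw [hγ, mul_pow, mul_pow, Real.sq_sqrt (by norm_num)]
    norm_num
  filter_upwards [ae_eventually_sum_vecMul_sq_le P hσw hinit] with ω hω
  obtain ⟨N, hN⟩ := eventually_atTop.1 hω
  refine ⟨N, fun n hn x _ => ?_⟩
  have hT := dist_deqTransition_le hφ (U n ω) hγ0 (W := W n ω) (by simpa only [hγ2] using hN n hn) x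
  refine ⟨fun l k hlk => norm_deqLayer_sub_deqLayer_le hγ0 hγ1 hT hlk,
    exists_tendsto_deqLayer hγ0 hγ1 hT, fun l => ?_⟩
  simpa [deqLayer, norm_sub_rev] using norm_deqLayer_sub_deqLayer_le hγ0 hγ1 hT (Nat.zero_le l)
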